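/- Let $n,k,p\ge 1$, $M\ge 0$ and $\delta\in(0,1]$. Let $\phi:\mathbb R^p\to\mathbb R$ be differentiable and convex, with Bregman divergence $d_\phi(x,y)=\phi(x)-\phi(y)-\langle\nabla\phi(y),x-y\rangle$. Let $\Psi=\Psi_\alpha:\mathbb R^k_{\ge0}\to\mathbb R_{\ge0}$ (with the hyperparameter $\alpha$ fixed) be non-decreasing in each component with $\Psi(0)=0$. For $\Theta=(\theta_1,\dots,\theta_k)\in\mathbb R^{k\times p}$ put $f_\Theta(x)=\Psi(d_\phi(x,\theta_1),\dots,d_\phi(x,\theta_k))$. Assume: (A1) $X_1,\dots,X_n$ are i.i.d. with law $P$, a Borel probability measure on $\mathbb R^p$ with $P([-M,M]^p)=1$; (A2) $|\Psi(x)-\Psi(y)|\le\tau\|x-y\|_1$ for all $x,y\in\mathbb R^k_{\ge0}$, where $\tau=\tau_{\alpha,k}$; (A3) $\|\nabla\phi(x)-\nabla\phi(y)\|_2\le H_p\|x-y\|_2$ for all $x,y\in[-M,M]^p$, where $H_p\ge0$. Write $Pf_\Theta=\int f_\Theta\,dP$ and $P_nf_\Theta=\frac1n\sum_{i=1}^n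 f_\Theta(X_i)$. Let $\Theta^*$ be a global minimizer of $\Theta\mapsto Pf_\Theta$ over $\mathbb R^{k\times p}$. Let $\widehat\Theta_n$ be (almost surely) a global minimizer of $\Theta\mapsto P_nf_\Theta$ over $\mathbb R^{k\times p}$, chosen in $[-M,M]^{k\times p}$ whenever the global minimizer is not unique. Then, with probability at least $1-\delta$, $$|Pf_{\widehat\Theta_n}-Pf_{\Theta^*}|\le 192\sqrt{\pi}\,\tau H_pM^2(kp)^{3/2}n^{-1/2}+8\tau H_pM^2pk\sqrt{\frac{\log(2/\delta)}{2n}}.$$ -/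

import Mathlib

open MeasureTheory ProbabilityTheory

noncomputable section

/-- The Bregman divergence `d_φ(x, y) = φ x - φ y - ⟨∇ φ y, x - y⟩` generated by `φ`. -/
def bregmanDiv {p : ℕ} (φ : EuclideanSpace ℝ (Fin p) → ℝ) (x y : EuclideanSpace ℝ (Fin p)) : ℝ :=
  φ x - φ y - inner ℝ (gradient φ y) (x - y)

/-- The cube `[-M, M]^p`. -/
def cube (p : ℕ) (M : ℝ) : Set (EuclideanSpace ℝ (Fin p)) :=
  {x | ∀ i, x i ∈ Set.Icc (-M) M}

/-- The loss `f_Θ(x) = Ψ (d_φ(x, θ₁), …, d_φ(x, θ_k))` of the centroids `Θ = (θ₁, …, θ_k)`. -/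
def clusterLoss {p k : ℕ} (φ : EuclideanSpace ℝ (Fin p) → ℝ) (Ψ : (Fin k → ℝ) → ℝ)
    (Θ : Fin k → EuclideanSpace ℝ (Fin p)) (x : EuclideanSpace ℝ (Fin p)) : ℝ :=
  Ψ fun j => bregmanDiv φ x (Θ j)

/-- The population risk `P f_Θ = ∫ f_Θ dP`. -/
def populationRisk {p k : ℕ} (φ : EuclideanSpace ℝ (Fin p) → ℝ) (Ψ : (Fin k → ℝ) → ℝ)
    (P : Measure (EuclideanSpace ℝ (Fin p))) (Θ : Fin k → EuclideanSpace ℝ (Fin p)) : ℝ :=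
  ∫ x, clusterLoss φ Ψ Θ x ∂P

/-- The empirical risk `P_n f_Θ = (1/n) ∑ i, f_Θ(x_i)` of a sample `x₁, …, x_n`. -/
def empiricalRisk {p k n : ℕ} (φ : EuclideanSpace ℝ (Fin p) → ℝ) (Ψ : (Fin k → ℝ) → ℝ)
    (x : Fin n → EuclideanSpace ℝ (Fin p)) (Θ : Fin k → EuclideanSpace ℝ (Fin p)) : ℝ :=
  (1 / (n : ℝ)) * ∑ i, clusterLoss φ Ψ Θ (x i)

/-- `Θ` is a global minimizer of the risk `R` over all of `ℝ^{k × p}`. -/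
def IsGlobalMinimizer {p k : ℕ} (R : (Fin k → EuclideanSpace ℝ (Fin p)) → ℝ)
    (Θ : Fin k → EuclideanSpace ℝ (Fin p)) : Prop :=
  ∀ Θ' : Fin k → EuclideanSpace ℝ (Fin p), R Θ ≤ R Θ'

/-- The aggregation function `Ψ : ℝ^k_{≥ 0} → ℝ_{≥ 0}` (only its values on the nonnegative orthant
matter): nonnegative, zero at the origin, and non-decreasing in each component. -/
structure IsAggregator {k : ℕ} (Ψ : (Fin k → ℝ) → ℝ) : Prop where
  nonneg : ∀ x : Fin k → ℝ, 0 ≤ x → 0 ≤ Ψ x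
  map_zero : Ψ 0 = 0
  monotoneOn : MonotoneOn Ψ (Set.Ici 0)

end

/-! ### Geometry of Bregman divergences on the cube. -/

section Bregman

variable {p : ℕ} {φ : EuclideanSpace ℝ (Fin p) → ℝ} {M H : ℝ}

/-! Both minimizers can be replaced by centroids in the cube: Bregman projection onto the cube
lowers the divergence from every point of the cube, and `Ψ` is monotone
(`exists_mem_cube_clusterLoss_le`). The usual comparison through the empirical risk then bounds the
excess risk by twice the supremum of `|P_n f_Θ - P f_Θ|` over the cube.

This supremum is controlled by chaining with Hoeffding's inequality and union bounds over dyadic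
grids of the `k * p` coordinates (`exists_forall_abs_empiricalDeviation_le`). Put `B = 4 τ k H M²
p`. The Lipschitz gradient of `φ` and the Lipschitz bound on `Ψ` confine the loss to `[0, 3B/4]` and
turn grid mesh into uniform approximation of the losses.

The `log (2 / δ)` term of the claim is exactly `2B √(log (2/δ)) / √(2n)`, so its coefficient has no
slack: the ranges of the base level and of all chaining increments must add up to at most `B`. They
add up to `3B/4 + 3B/16`. The dimension term, by contrast, has ample room. -/

lemma ConvexOn.add_inner_gradient_le (hc : ConvexOn ℝ Set.univ φ) (hd : Differentiable ℝ φ)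
    (x y : EuclideanSpace ℝ (Fin p)) : φ y + inner ℝ (gradient φ y) (x - y) ≤ φ x := by
  have hg : ConvexOn ℝ Set.univ (fun t : ℝ => φ (AffineMap.lineMap y x t)) :=
    hc.comp_affineMap (AffineMap.lineMap y x)
  have h1 : HasDerivAt (fun t : ℝ => φ (AffineMap.lineMap y x t))
      (inner ℝ (gradient φ y) (x - y)) 0 := by
    have h2 : HasFDerivAt φ (fderiv ℝ φ y) (AffineMap.lineMap y x (0 : ℝ)) := by
      simpa using (hd y).hasFDerivAt
    have h3 := h2.comp_hasDerivAt (0 : ℝ) (AffineMap.hasDerivAt_lineMap (a := y) (b := x))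
    rw [inner_gradient_left]
    exact h3
  have h4 := hg.le_slope_of_hasDerivAt (Set.mem_univ 0) (Set.mem_univ 1) zero_lt_one h1
  simp only [slope_def_field, AffineMap.lineMap_apply_one, AffineMap.lineMap_apply_zero] at h4
  linarith

lemma bregmanDiv_nonneg (hc : ConvexOn ℝ Set.univ φ) (hd : Differentiable ℝ φ)
    (x y : EuclideanSpace ℝ (Fin p)) : 0 ≤ bregmanDiv φ x y := by
  have := hc.add_inner_gradient_le hd x y
  unfold bregmanDiv
  linarith

lemma continuous_bregmanDiv_left (hd : Differentiable ℝ φ) (y : EuclideanSpace ℝ (Fin p)) :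
    Continuous fun x => bregmanDiv φ x y := by
  have := hd.continuous
  unfold bregmanDiv
  fun_prop

/-- The three point identity of Bregman divergences. -/
lemma bregmanDiv_sub_bregmanDiv (x y z : EuclideanSpace ℝ (Fin p)) :
    bregmanDiv φ x y - bregmanDiv φ x z
      = bregmanDiv φ z y + inner ℝ (gradient φ z - gradient φ y) (x - z) := by
  have : x - y = (x - z) + (z - y) := by abel
  unfold bregmanDiv
  rw [this, inner_add_right, inner_sub_left]
  ring

lemma convex_cube : Convex ℝ (cube p M) := by
  intro x hx y hy a b ha hb hab i
  have := (convex_Icc (-M) M) (hx i) (hy i) ha hb hab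
  simpa using this

lemma isClosed_cube : IsClosed (cube p M) := by
  have : cube p M = ⋂ i, (fun x : EuclideanSpace ℝ (Fin p) => x i) ⁻¹' Set.Icc (-M) M := by
    ext x; simp [cube]
  rw [this]
  exact isClosed_iInter fun i => isClosed_Icc.preimage (by fun_prop)

lemma norm_le_sqrt_mul {ε : ℝ} (hε : 0 ≤ ε) {v : EuclideanSpace ℝ (Fin p)}
    (hv : ∀ i, |v i| ≤ ε) : ‖v‖ ≤ √p * ε := by
  rw [EuclideanSpace.norm_eq]
  apply Real.sqrt_le_iff.2 ⟨by positivity, ?_⟩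
  rw [mul_pow, Real.sq_sqrt (Nat.cast_nonneg p)]
  calc ∑ i, ‖v i‖ ^ 2 ≤ ∑ _i : Fin p, ε ^ 2 := by
        gcongr with i
        exact hv i
    _ = p * ε ^ 2 := by simp

lemma norm_sub_le_of_mem_cube (hM : 0 ≤ M) {x y : EuclideanSpace ℝ (Fin p)} (hx : x ∈ cube p M)
    (hy : y ∈ cube p M) : ‖x - y‖ ≤ √p * (2 * M) := by
  refine norm_le_sqrt_mul (by positivity) fun i => ?_
  have h1 := hx i
  have h2 := hy i
  simp only [Set.mem_Icc] at h1 h2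
  rw [PiLp.sub_apply, abs_le]
  constructor <;> linarith

lemma isCompact_cube : IsCompact (cube p M) := by
  rcases le_or_gt 0 M with hM | hM
  · refine Metric.isCompact_of_isClosed_isBounded isClosed_cube ?_
    refine Metric.isBounded_iff.2 ⟨√p * (2 * M), fun x hx y hy => ?_⟩
    rw [dist_eq_norm]
    exact norm_sub_le_of_mem_cube hM hx hy
  · rcases Nat.eq_zero_or_pos p with rfl | hp
    · exact Set.Subsingleton.isCompact (Set.subsingleton_of_subsingleton)
    · have : cube p M = ∅ := by
        ext x
        simp only [Set.mem_empty_iff_false, iff_false]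
        intro hx
        have := hx ⟨0, hp⟩
        simp only [Set.mem_Icc] at this
        linarith
      rw [this]
      exact isCompact_empty

/-- Bregman projection: moving a centroid into the cube does not increase its divergence from
the points of the cube. -/
lemma exists_mem_cube_bregmanDiv_le (hM : 0 ≤ M) (hc : ConvexOn ℝ Set.univ φ)
    (hd : Differentiable ℝ φ) (y : EuclideanSpace ℝ (Fin p)) :
    ∃ z ∈ cube p M, ∀ x ∈ cube p M, bregmanDiv φ x z ≤ bregmanDiv φ x y := by
  obtain ⟨z, hz, hmin⟩ := (isCompact_cube (p := p) (M := M)).exists_isMinOn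
    ⟨0, fun i => by simpa using hM⟩ (continuous_bregmanDiv_left hd y).continuousOn
  refine ⟨z, hz, fun x hx => ?_⟩
  have h1 : HasFDerivAt (fun x => bregmanDiv φ x y)
      (fderiv ℝ φ z - innerSL ℝ (gradient φ y)) z := by
    have h2 : HasFDerivAt (fun x => inner ℝ (gradient φ y) (x - y)) (innerSL ℝ (gradient φ y)) z :=
      (innerSL ℝ (gradient φ y)).hasFDerivAt.comp z ((hasFDerivAt_id z).sub_const y)
    exact ((hd z).hasFDerivAt.sub_const (φ y)).sub h2
  -- First-order optimality of `z` on the convex cube. It makes the inner product in the three point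
  -- identity nonnegative; the other term there, `d_φ(z, y)`, is nonnegative by convexity.
  have h3 := (IsMinOn.localize hmin).hasFDerivWithinAt_nonneg h1.hasFDerivWithinAt
    (sub_mem_posTangentConeAt_of_segment_subset (convex_cube.segment_subset hz hx))
  have h4 : 0 ≤ inner ℝ (gradient φ z - gradient φ y) (x - z) := by
    rw [inner_sub_left, inner_gradient_left]
    exact h3
  have h5 := bregmanDiv_sub_bregmanDiv (φ := φ) x y z
  have h6 := bregmanDiv_nonneg hc hd z y
  linarith

lemma inner_gradient_sub_le
    (hL : ∀ x ∈ cube p M, ∀ y ∈ cube p M, ‖gradient φ x - gradient φ y‖ ≤ H * ‖x - y‖)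
    {x y : EuclideanSpace ℝ (Fin p)} (hx : x ∈ cube p M) (hy : y ∈ cube p M)
    (v : EuclideanSpace ℝ (Fin p)) :
    |inner ℝ (gradient φ x - gradient φ y) v| ≤ H * ‖x - y‖ * ‖v‖ :=
  (abs_real_inner_le_norm _ _).trans (by gcongr; exact hL x hx y hy)

/-- Tangent inequalities at `x` and at the midpoint `m` bound the two halves of `φ x - φ y`, giving
`1/2 + 1/4` after Cauchy–Schwarz. A single tangent at `x` would give the constant `1`, hence a loss
range of all of `B`, with nothing left for the chaining increments. -/
lemma bregmanDiv_le_norm_sq (hc : ConvexOn ℝ Set.univ φ) (hd : Differentiable ℝ φ)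
    (hL : ∀ x ∈ cube p M, ∀ y ∈ cube p M, ‖gradient φ x - gradient φ y‖ ≤ H * ‖x - y‖)
    {x y : EuclideanSpace ℝ (Fin p)} (hx : x ∈ cube p M) (hy : y ∈ cube p M) :
    bregmanDiv φ x y ≤ 3 / 4 * H * ‖x - y‖ ^ 2 := by
  set m := (1 / 2 : ℝ) • x + (1 / 2 : ℝ) • y with hm_def
  have hm : m ∈ cube p M := convex_cube hx hy (by norm_num) (by norm_num) (by norm_num)
  have e1 : x - m = (1 / 2 : ℝ) • (x - y) := by rw [hm_def]; module
  have e2 : m - y = (1 / 2 : ℝ) • (x - y) := by rw [hm_def]; module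
  have h1 := hc.add_inner_gradient_le hd m x
  have h2 := hc.add_inner_gradient_le hd y m
  rw [← neg_sub, inner_neg_right, e1, inner_smul_right] at h1
  rw [← neg_sub, inner_neg_right, e2, inner_smul_right] at h2
  have h3 := (le_abs_self _).trans (inner_gradient_sub_le hL hx hy (x - y))
  have h4 := (le_abs_self _).trans (inner_gradient_sub_le hL hm hy (x - y))
  rw [e2, norm_smul, show ‖(1 / 2 : ℝ)‖ = 1 / 2 by norm_num] at h4
  rw [inner_sub_left] at h3 h4
  unfold bregmanDiv
  linarith

/-- By the three point identity the difference is `d_φ(z, y)` plus an inner product. Bounding one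
factor `‖z - y‖` by the diameter makes the quadratic part linear in `ε`; the constants are `3/2 + 2
≤ 4`. -/
lemma abs_bregmanDiv_sub_le (hM : 0 ≤ M) (hc : ConvexOn ℝ Set.univ φ) (hd : Differentiable ℝ φ)
    (hH : 0 ≤ H)
    (hL : ∀ x ∈ cube p M, ∀ y ∈ cube p M, ‖gradient φ x - gradient φ y‖ ≤ H * ‖x - y‖)
    {x y z : EuclideanSpace ℝ (Fin p)} (hx : x ∈ cube p M) (hy : y ∈ cube p M)
    (hz : z ∈ cube p M) {ε : ℝ} (hε : 0 ≤ ε) (hyz : ∀ i, |y i - z i| ≤ ε) :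
    |bregmanDiv φ x y - bregmanDiv φ x z| ≤ 4 * H * M * p * ε := by
  rw [bregmanDiv_sub_bregmanDiv]
  have h0 := bregmanDiv_nonneg hc hd z y
  have h1 := bregmanDiv_le_norm_sq hc hd hL hz hy
  have h2 := inner_gradient_sub_le hL hz hy (x - z)
  have h3 : ‖z - y‖ ≤ √p * ε := by
    rw [norm_sub_rev]
    exact norm_le_sqrt_mul hε hyz
  have h4 := norm_sub_le_of_mem_cube hM hz hy
  have h5 := norm_sub_le_of_mem_cube hM hx hz
  have hp : √(p : ℝ) * √p = p := Real.mul_self_sqrt (Nat.cast_nonneg p)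
  have h6 : ‖z - y‖ ^ 2 ≤ 2 * M * p * ε := by
    calc ‖z - y‖ ^ 2 = ‖z - y‖ * ‖z - y‖ := sq _
      _ ≤ (√p * (2 * M)) * (√p * ε) := by gcongr
      _ = 2 * M * (√p * √p) * ε := by ring
      _ = _ := by rw [hp]
  have h7 : H * ‖z - y‖ * ‖x - z‖ ≤ H * (2 * M * p * ε) := by
    calc H * ‖z - y‖ * ‖x - z‖ ≤ H * (√p * ε) * (√p * (2 * M)) := by gcongr
      _ = H * (2 * M * (√p * √p) * ε) := by ring
      _ = _ := by rw [hp]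
  have h8 : H * ‖z - y‖ ^ 2 ≤ H * (2 * M * p * ε) := by gcongr
  have h9 : 0 ≤ H * ‖z - y‖ ^ 2 := by positivity
  refine (abs_add_le _ _).trans ?_
  rw [abs_of_nonneg h0]
  linarith

lemma bregmanDiv_le_of_mem_cube (hM : 0 ≤ M) (hc : ConvexOn ℝ Set.univ φ)
    (hd : Differentiable ℝ φ) (hH : 0 ≤ H)
    (hL : ∀ x ∈ cube p M, ∀ y ∈ cube p M, ‖gradient φ x - gradient φ y‖ ≤ H * ‖x - y‖)
    {x y : EuclideanSpace ℝ (Fin p)} (hx : x ∈ cube p M) (hy : y ∈ cube p M) :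
    bregmanDiv φ x y ≤ 3 * H * M ^ 2 * p := by
  have h1 := bregmanDiv_le_norm_sq hc hd hL hx hy
  have h2 : ‖x - y‖ ^ 2 ≤ (√p * (2 * M)) ^ 2 := by
    gcongr
    exact norm_sub_le_of_mem_cube hM hx hy
  rw [mul_pow, Real.sq_sqrt (Nat.cast_nonneg p)] at h2
  have h3 := mul_le_mul_of_nonneg_left h2 hH
  linarith

end Bregman

/-! ### Range, regularity and grid approximation of the clustering loss. -/

section ClusterLoss

variable {p k : ℕ} {φ : EuclideanSpace ℝ (Fin p) → ℝ} {Ψ : (Fin k → ℝ) → ℝ} {M H τ : ℝ}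

lemma continuousOn_Ici_of_lipschitz
    (hτ : ∀ x y : Fin k → ℝ, 0 ≤ x → 0 ≤ y → |Ψ x - Ψ y| ≤ τ * ∑ j, |x j - y j|) :
    ContinuousOn Ψ (Set.Ici 0) := by
  intro x hx
  rw [ContinuousWithinAt, tendsto_iff_dist_tendsto_zero]
  have h1 : Filter.Tendsto (fun y : Fin k → ℝ => τ * ∑ j, |y j - x j|)
      (nhdsWithin x (Set.Ici 0)) (nhds 0) := by
    have h2 : Continuous (fun y : Fin k → ℝ => τ * ∑ j, |y j - x j|) := by fun_prop
    have h3 := (h2.tendsto x).mono_left (nhdsWithin_le_nhds (s := Set.Ici 0))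
    simpa using h3
  refine squeeze_zero' (Filter.Eventually.of_forall fun _ => dist_nonneg) ?_ h1
  filter_upwards [self_mem_nhdsWithin] with y hy
  exact hτ y x hy hx

lemma continuous_clusterLoss (hc : ConvexOn ℝ Set.univ φ) (hd : Differentiable ℝ φ)
    (hτ : ∀ x y : Fin k → ℝ, 0 ≤ x → 0 ≤ y → |Ψ x - Ψ y| ≤ τ * ∑ j, |x j - y j|)
    (Θ : Fin k → EuclideanSpace ℝ (Fin p)) : Continuous (clusterLoss φ Ψ Θ) :=
  (continuousOn_Ici_of_lipschitz hτ).comp_continuous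
    (continuous_pi fun j => continuous_bregmanDiv_left hd (Θ j))
    fun x j => bregmanDiv_nonneg hc hd x (Θ j)

lemma clusterLoss_nonneg (hc : ConvexOn ℝ Set.univ φ) (hd : Differentiable ℝ φ)
    (hΨ : IsAggregator Ψ) (Θ : Fin k → EuclideanSpace ℝ (Fin p)) (x : EuclideanSpace ℝ (Fin p)) :
    0 ≤ clusterLoss φ Ψ Θ x :=
  hΨ.nonneg _ fun j => bregmanDiv_nonneg hc hd x (Θ j)

/-- Stated for `τ * k` because `τ` may be negative when `k = 0`. -/
lemma lipschitzConst_mul_nonneg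
    (hτ : ∀ x y : Fin k → ℝ, 0 ≤ x → 0 ≤ y → |Ψ x - Ψ y| ≤ τ * ∑ j, |x j - y j|) :
    0 ≤ τ * k := by
  have := hτ 1 0 (fun _ => zero_le_one) le_rfl
  simp only [Pi.one_apply, Pi.zero_apply, sub_zero, abs_one, Finset.sum_const, Finset.card_univ,
    Fintype.card_fin, nsmul_eq_mul, mul_one] at this
  exact (abs_nonneg _).trans this

lemma lipschitz_le_of_forall_le
    (hτ : ∀ x y : Fin k → ℝ, 0 ≤ x → 0 ≤ y → |Ψ x - Ψ y| ≤ τ * ∑ j, |x j - y j|)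
    {x y : Fin k → ℝ} (hx : 0 ≤ x) (hy : 0 ≤ y) {c : ℝ} (h : ∀ j, |x j - y j| ≤ c) :
    |Ψ x - Ψ y| ≤ τ * k * c := by
  rcases Nat.eq_zero_or_pos k with rfl | hk
  · simpa using hτ x y hx hy
  · have hk' : (0 : ℝ) < k := by exact_mod_cast hk
    have hτ0 : 0 ≤ τ := nonneg_of_mul_nonneg_left (lipschitzConst_mul_nonneg hτ) hk'
    calc |Ψ x - Ψ y| ≤ τ * ∑ j, |x j - y j| := hτ x y hx hy
      _ ≤ τ * ∑ _j : Fin k, c := by gcongr with j; exact h j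
      _ = τ * k * c := by simp; ring

lemma clusterLoss_le_of_mem_cube (hM : 0 ≤ M) (hc : ConvexOn ℝ Set.univ φ)
    (hd : Differentiable ℝ φ) (hH : 0 ≤ H)
    (hL : ∀ x ∈ cube p M, ∀ y ∈ cube p M, ‖gradient φ x - gradient φ y‖ ≤ H * ‖x - y‖)
    (hΨ : IsAggregator Ψ)
    (hτ : ∀ x y : Fin k → ℝ, 0 ≤ x → 0 ≤ y → |Ψ x - Ψ y| ≤ τ * ∑ j, |x j - y j|)
    {Θ : Fin k → EuclideanSpace ℝ (Fin p)} (hΘ : ∀ j, Θ j ∈ cube p M)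
    {x : EuclideanSpace ℝ (Fin p)} (hx : x ∈ cube p M) :
    clusterLoss φ Ψ Θ x ≤ τ * k * (3 * H * M ^ 2 * p) := by
  have h := lipschitz_le_of_forall_le hτ (x := fun j => bregmanDiv φ x (Θ j)) (y := 0)
    (c := 3 * H * M ^ 2 * p) (fun j => bregmanDiv_nonneg hc hd x (Θ j)) le_rfl fun j => by
      rw [Pi.zero_apply, sub_zero, abs_of_nonneg (bregmanDiv_nonneg hc hd x (Θ j))]
      exact bregmanDiv_le_of_mem_cube hM hc hd hH hL hx (hΘ j)
  rw [hΨ.map_zero, sub_zero] at h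
  exact (le_abs_self _).trans h

lemma abs_clusterLoss_sub_le (hM : 0 ≤ M) (hc : ConvexOn ℝ Set.univ φ)
    (hd : Differentiable ℝ φ) (hH : 0 ≤ H)
    (hL : ∀ x ∈ cube p M, ∀ y ∈ cube p M, ‖gradient φ x - gradient φ y‖ ≤ H * ‖x - y‖)
    (hτ : ∀ x y : Fin k → ℝ, 0 ≤ x → 0 ≤ y → |Ψ x - Ψ y| ≤ τ * ∑ j, |x j - y j|)
    {Θ Θ' : Fin k → EuclideanSpace ℝ (Fin p)} (hΘ : ∀ j, Θ j ∈ cube p M)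
    (hΘ' : ∀ j, Θ' j ∈ cube p M) {ε : ℝ} (hε : 0 ≤ ε) (h : ∀ j i, |Θ j i - Θ' j i| ≤ ε)
    {x : EuclideanSpace ℝ (Fin p)} (hx : x ∈ cube p M) :
    |clusterLoss φ Ψ Θ x - clusterLoss φ Ψ Θ' x| ≤ τ * k * (4 * H * M * p * ε) :=
  lipschitz_le_of_forall_le hτ (fun j => bregmanDiv_nonneg hc hd x (Θ j))
    (fun j => bregmanDiv_nonneg hc hd x (Θ' j)) fun j =>
      abs_bregmanDiv_sub_le hM hc hd hH hL hx (hΘ j) (hΘ' j) hε (h j)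

/-- Every choice of centroids can be moved into the cube without increasing the loss on the cube. -/
lemma exists_mem_cube_clusterLoss_le (hM : 0 ≤ M) (hc : ConvexOn ℝ Set.univ φ)
    (hd : Differentiable ℝ φ) (hΨ : IsAggregator Ψ) (Θ : Fin k → EuclideanSpace ℝ (Fin p)) :
    ∃ Θ' : Fin k → EuclideanSpace ℝ (Fin p), (∀ j, Θ' j ∈ cube p M) ∧
      ∀ x ∈ cube p M, clusterLoss φ Ψ Θ' x ≤ clusterLoss φ Ψ Θ x := by
  choose Θ' h1 h2 using fun j => exists_mem_cube_bregmanDiv_le (M := M) hM hc hd (Θ j)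
  exact ⟨Θ', h1, fun x hx => hΨ.monotoneOn (fun j => bregmanDiv_nonneg hc hd x (Θ' j))
    (fun j => bregmanDiv_nonneg hc hd x (Θ j)) fun j => h2 j x hx⟩

/-- A global minimizer of the empirical risk of a sample in the cube lies in the cube, if it does
so whenever it is not unique. -/
lemma IsGlobalMinimizer.mem_cube_of_empiricalRisk {n : ℕ} (hM : 0 ≤ M)
    (hc : ConvexOn ℝ Set.univ φ) (hd : Differentiable ℝ φ) (hΨ : IsAggregator Ψ)
    {x : Fin n → EuclideanSpace ℝ (Fin p)} (hx : ∀ i, x i ∈ cube p M)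
    {Θ : Fin k → EuclideanSpace ℝ (Fin p)} (hΘ : IsGlobalMinimizer (empiricalRisk φ Ψ x) Θ)
    (hcube : (∃ Θ', Θ' ≠ Θ ∧ IsGlobalMinimizer (empiricalRisk φ Ψ x) Θ') → ∀ j, Θ j ∈ cube p M) :
    ∀ j, Θ j ∈ cube p M := by
  obtain ⟨Θ', h1, h2⟩ := exists_mem_cube_clusterLoss_le hM hc hd hΨ Θ
  -- The projected centroids are again a minimizer: either they equal `Θ`, or they witness
  -- non-uniqueness.
  by_cases h : Θ' = Θ
  · exact h ▸ h1
  · refine hcube ⟨Θ', h, fun Θ'' => le_trans ?_ (hΘ Θ'')⟩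
    unfold empiricalRisk
    gcongr with i
    exact h2 _ (hx i)

/-- The cube has grids of `2 ^ m` points per coordinate and mesh `2 * M / 2 ^ m`. -/
lemma exists_grid_cube (k : ℕ) (p : ℕ) (hM : 0 ≤ M) (m : ℕ) :
    ∃ T : Finset (Fin k → EuclideanSpace ℝ (Fin p)), T.card ≤ 2 ^ (m * (k * p)) ∧
      (∀ Θ ∈ T, ∀ j, Θ j ∈ cube p M) ∧
      ∀ Θ : Fin k → EuclideanSpace ℝ (Fin p), (∀ j, Θ j ∈ cube p M) →
        ∃ Θ' ∈ T, ∀ j i, |Θ j i - Θ' j i| ≤ 2 * M / 2 ^ m := by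
  classical
  have h2 : (0 : ℝ) < 2 ^ m := by positivity
  have hr : ∀ t ∈ Set.Icc (-M) M, ∃ a : Fin (2 ^ m),
      |t - (-M + a * (2 * M / 2 ^ m))| ≤ 2 * M / 2 ^ m := by
    intro t ht
    simp only [Set.mem_Icc] at ht
    rcases hM.eq_or_lt with rfl | hM'
    · exact ⟨⟨0, by positivity⟩, by simp; linarith⟩
    have hw : 0 < 2 * M / 2 ^ m := by positivity
    have hs : 0 ≤ (t + M) / (2 * M / 2 ^ m) := div_nonneg (by linarith) hw.le
    by_cases hfl : ⌊(t + M) / (2 * M / 2 ^ m)⌋₊ < 2 ^ m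
    · refine ⟨⟨_, hfl⟩, ?_⟩
      have h3 := Nat.floor_le hs
      have h4 := Nat.lt_floor_add_one ((t + M) / (2 * M / 2 ^ m))
      rw [le_div_iff₀ hw] at h3
      rw [div_lt_iff₀ hw] at h4
      rw [abs_le]
      constructor <;> simp only <;> linarith
    -- The grid consists of left endpoints of cells, so the right end `t = M` is assigned to the
    -- last cell.
    · refine ⟨⟨2 ^ m - 1, Nat.sub_lt (by positivity) one_pos⟩, ?_⟩
      have h3 : ((2 ^ m : ℕ) : ℝ) ≤ (t + M) / (2 * M / 2 ^ m) :=
        (Nat.le_floor_iff hs).1 (not_lt.1 hfl)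
      rw [le_div_iff₀ hw] at h3
      push_cast at h3
      have h4 : (2 : ℝ) ^ m * (2 * M / 2 ^ m) = 2 * M := by field_simp
      have h5 : (((2 ^ m - 1 : ℕ) : ℕ) : ℝ) = 2 ^ m - 1 := by
        rw [Nat.cast_sub Nat.one_le_two_pow]; simp
      simp only [h5, sub_mul, h4, one_mul]
      rw [h4] at h3
      rw [abs_le]
      constructor <;> linarith
  let g : (Fin k → Fin p → Fin (2 ^ m)) → Fin k → EuclideanSpace ℝ (Fin p) :=
    fun a j => WithLp.toLp 2 fun i => -M + a j i * (2 * M / 2 ^ m)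
  refine ⟨Finset.univ.image g, ?_, ?_, fun Θ hΘ => ?_⟩
  · refine Finset.card_image_le.trans ?_
    simp only [Finset.card_univ, Fintype.card_fun, Fintype.card_fin]
    rw [← pow_mul, ← pow_mul, mul_comm k p]
  · intro Θ hΘ j i
    obtain ⟨a, -, rfl⟩ := Finset.mem_image.1 hΘ
    have h3 : ((a j i : ℕ) : ℝ) ≤ 2 ^ m := by exact_mod_cast (a j i).2.le
    have h4 : (2 : ℝ) ^ m * (2 * M / 2 ^ m) = 2 * M := by field_simp
    have h5 : ((a j i : ℕ) : ℝ) * (2 * M / 2 ^ m) ≤ 2 * M := by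
      exact (mul_le_mul_of_nonneg_right h3 (by positivity)).trans_eq h4
    have h6 : 0 ≤ ((a j i : ℕ) : ℝ) * (2 * M / 2 ^ m) := by positivity
    simp only [g, Set.mem_Icc]
    constructor <;> linarith
  · choose a ha using fun j i => hr (Θ j i) (hΘ j i)
    exact ⟨g a, Finset.mem_image_of_mem _ (Finset.mem_univ _), ha⟩

end ClusterLoss

/-! ### Hoeffding's inequality for empirical means. -/

section Hoeffding

variable {Ω 𝓧 : Type*} [MeasurableSpace Ω] [MeasurableSpace 𝓧] {n : ℕ}

/-- The deviation `P_n f - P f` of the empirical mean of `f` over the sample `x` from its mean. -/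
noncomputable def empiricalDeviation (P : Measure 𝓧) (x : Fin n → 𝓧) (f : 𝓧 → ℝ) : ℝ :=
  (1 / (n : ℝ)) * ∑ i, f (x i) - ∫ y, f y ∂P

lemma empiricalDeviation_sub (P : Measure 𝓧) (x : Fin n → 𝓧) {f g : 𝓧 → ℝ}
    (hf : Integrable f P) (hg : Integrable g P) :
    empiricalDeviation P x (fun y => f y - g y)
      = empiricalDeviation P x f - empiricalDeviation P x g := by
  unfold empiricalDeviation
  rw [integral_sub hf hg, Finset.sum_sub_distrib]
  ring

lemma abs_empiricalDeviation_le {P : Measure 𝓧} [IsProbabilityMeasure P] {K : Set 𝓧}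
    (hK : ∀ᵐ y ∂P, y ∈ K) {x : Fin n → 𝓧} (hx : ∀ i, x i ∈ K) {f : 𝓧 → ℝ} {c : ℝ} (hc : 0 ≤ c)
    (hf : ∀ y ∈ K, |f y| ≤ c) : |empiricalDeviation P x f| ≤ 2 * c := by
  have h1 : |(1 / (n : ℝ)) * ∑ i, f (x i)| ≤ c := by
    rw [abs_mul, abs_of_nonneg (by positivity)]
    calc 1 / (n : ℝ) * |∑ i, f (x i)| ≤ 1 / (n : ℝ) * ∑ _i : Fin n, c := by
          gcongr
          exact (Finset.abs_sum_le_sum_abs _ _).trans (Finset.sum_le_sum fun i _ => hf _ (hx i))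
      _ = (n : ℝ) / n * c := by simp; ring
      _ ≤ 1 * c := by gcongr; exact div_self_le_one _
      _ = c := one_mul c
  have h2 : |∫ y, f y ∂P| ≤ c := by
    have := norm_integral_le_of_norm_le_const (μ := P) (f := f) (C := c)
      (by filter_upwards [hK] with y hy using hf y hy)
    simpa using this
  exact (abs_sub _ _).trans (by linarith)

variable {μ : Measure Ω} [IsProbabilityMeasure μ] {P : Measure 𝓧}

/-- Hoeffding's inequality for the empirical mean of a bounded function, one-sided. -/
lemma measureReal_lt_empiricalDeviation_le (hn : 0 < n) {X : Fin n → Ω → 𝓧}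
    (hX : iIndepFun X μ) (hP : ∀ i, HasLaw (X i) P μ) {f : 𝓧 → ℝ} (hf : Measurable f)
    {a b : ℝ} (hab : a < b) (hfab : ∀ᵐ y ∂P, f y ∈ Set.Icc a b) {r : ℝ} (hr : 0 ≤ r) :
    μ.real {ω | (b - a) * r / √(2 * n) < empiricalDeviation P (fun i => X i ω) f}
      ≤ Real.exp (-r ^ 2) := by
  have hn' : (0 : ℝ) < n := by exact_mod_cast hn
  have hsub : ∀ i ∈ Finset.univ, HasSubgaussianMGF (fun ω => f (X i ω) - ∫ y, f y ∂P)
      ((‖b - a‖₊ / 2) ^ 2) μ := by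
    intro i _
    have h1 := hasSubgaussianMGF_of_mem_Icc (μ := μ) (X := fun ω => f (X i ω)) (a := a) (b := b)
      (hf.comp_aemeasurable (hP i).aemeasurable) (by
        have h2 : ∀ᵐ y ∂(μ.map (X i)), f y ∈ Set.Icc a b := by rwa [(hP i).map_eq]
        exact ae_of_ae_map (hP i).aemeasurable h2)
    rwa [show ∫ ω, f (X i ω) ∂μ = ∫ y, f y ∂P from
      (hP i).integral_comp hf.aestronglyMeasurable] at h1
  have hind : iIndepFun (fun i ω => f (X i ω) - ∫ y, f y ∂P) μ :=
    hX.comp (fun _ y => f y - ∫ y, f y ∂P) fun _ => hf.sub_const _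
  have hba : 0 < b - a := sub_pos.2 hab
  have hs : (0 : ℝ) < √(2 * n) := by positivity
  have h := HasSubgaussianMGF.measure_sum_ge_le_of_iIndepFun hind hsub
    (ε := n * ((b - a) * r / √(2 * n))) (by positivity)
  -- Each summand has variance proxy `((b - a) / 2)²`; the threshold is normalized so that the
  -- exponent is exactly `-r²`.
  have hexp : -(n * ((b - a) * r / √(2 * n))) ^ 2
      / (2 * ((∑ _i : Fin n, (‖b - a‖₊ / 2) ^ 2 : NNReal) : ℝ)) = -r ^ 2 := by
    simp only [Finset.sum_const, Finset.card_univ, Fintype.card_fin, nsmul_eq_mul]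
    push_cast
    rw [Real.norm_of_nonneg hba.le, mul_pow, div_pow, Real.sq_sqrt (by positivity)]
    field_simp
  rw [hexp] at h
  refine (measureReal_mono fun ω hω => ?_).trans h
  simp only [Set.mem_ofPred_eq, empiricalDeviation] at hω ⊢
  rw [Finset.sum_sub_distrib]
  simp only [Finset.sum_const, Finset.card_univ, Fintype.card_fin, nsmul_eq_mul]
  have h3 := mul_le_mul_of_nonneg_left hω.le hn'.le
  refine h3.trans_eq ?_
  field_simp

/-- Hoeffding's inequality for the empirical mean of a bounded function. -/
lemma measureReal_lt_abs_empiricalDeviation_le (hn : 0 < n) {X : Fin n → Ω → 𝓧}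
    (hX : iIndepFun X μ) (hP : ∀ i, HasLaw (X i) P μ) {f : 𝓧 → ℝ} (hf : Measurable f)
    {a b : ℝ} (hab : a < b) (hfab : ∀ᵐ y ∂P, f y ∈ Set.Icc a b) {r : ℝ} (hr : 0 ≤ r) :
    μ.real {ω | (b - a) * r / √(2 * n) < |empiricalDeviation P (fun i => X i ω) f|}
      ≤ 2 * Real.exp (-r ^ 2) := by
  have h1 := measureReal_lt_empiricalDeviation_le hn hX hP hf hab hfab hr
  have h2 := measureReal_lt_empiricalDeviation_le hn hX hP hf.neg (neg_lt_neg hab)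
    (by filter_upwards [hfab] with y hy using ⟨neg_le_neg hy.2, neg_le_neg hy.1⟩) hr
  have h3 : ∀ x : Fin n → 𝓧, empiricalDeviation P x (-f) = -empiricalDeviation P x f := by
    intro x
    simp only [empiricalDeviation, Pi.neg_apply, Finset.sum_neg_distrib, integral_neg]
    ring
  rw [neg_sub_neg] at h2
  calc _ ≤ _ := measureReal_mono (fun ω hω => ?_)
    _ ≤ _ := measureReal_union_le _ _
    _ ≤ _ := add_le_add h1 h2
    _ = _ := by ring
  rw [Set.mem_ofPred_eq, lt_abs] at hω
  rcases hω with hω | hω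
  · exact Or.inl hω
  · exact Or.inr (by rw [Set.mem_ofPred_eq, h3]; exact hω)

end Hoeffding

/-! ### Chaining over finite nets. -/

section Chaining

variable {Ω 𝓧 : Type*} [MeasurableSpace Ω] [MeasurableSpace 𝓧] {n : ℕ}
variable {μ : Measure Ω} {P : Measure 𝓧}

/-- Dropping the cross term, the square is at least `log (2/δ) + m`, and `exp (-m)` absorbs a union
bound over `2 ^ m` events. -/
lemma two_pow_mul_exp_neg_sq_le {δ : ℝ} (hδ : 0 < δ) (hδ1 : δ ≤ 1) {m : ℕ} {s d : ℝ}
    (hs : 0 ≤ s) (hd : 0 ≤ d) (hm : m ≤ s ^ 2 * d) :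
    2 ^ m * (2 * Real.exp (-(√(Real.log (2 / δ)) + s * √d) ^ 2)) ≤ δ := by
  have hl : 0 ≤ Real.log (2 / δ) := Real.log_nonneg (by rw [le_div_iff₀ hδ]; linarith)
  have h1 : Real.log (2 / δ) + m ≤ (√(Real.log (2 / δ)) + s * √d) ^ 2 := by
    have h2 : 0 ≤ √(Real.log (2 / δ)) * (s * √d) := by positivity
    rw [add_sq, Real.sq_sqrt hl, mul_pow, Real.sq_sqrt hd]
    linarith
  have h3 : (2 : ℝ) ^ m ≤ Real.exp m := by
    rw [← Real.exp_one_pow]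
    gcongr
    linarith [Real.add_one_le_exp (1 : ℝ)]
  calc 2 ^ m * (2 * Real.exp (-(√(Real.log (2 / δ)) + s * √d) ^ 2))
      ≤ Real.exp m * (2 * Real.exp (-(Real.log (2 / δ) + m))) := by gcongr
    _ = 2 * (Real.exp m * Real.exp (-(Real.log (2 / δ) + m))) := by ring
    _ = 2 * Real.exp (-Real.log (2 / δ)) := by rw [← Real.exp_add]; congr 2; ring
    _ = δ := by
      rw [Real.exp_neg, Real.exp_log (by positivity)]
      field_simp

lemma measureReal_biUnion_le_card_mul {ι : Type*} (s : Finset ι) (A : ι → Set Ω) {c : ℝ}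
    (h : ∀ i ∈ s, μ.real (A i) ≤ c) : μ.real (⋃ i ∈ s, A i) ≤ s.card * c := by
  refine (measureReal_biUnion_finset_le s A).trans ?_
  rw [← nsmul_eq_mul]
  exact Finset.sum_le_card_nsmul _ _ _ h

/-- A uniform deviation bound by chaining: the functions `f t` are approximated on the support of
`P` by finite nets, at level `j` up to `B / 2 ^ (j + 5)` by at most `2 ^ ((j + 6) * D)` functions. -/
theorem exists_forall_abs_empiricalDeviation_le [IsProbabilityMeasure μ]
    [IsProbabilityMeasure P] (hn : 0 < n) {X : Fin n → Ω → 𝓧}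
    (hX : iIndepFun X μ) (hP : ∀ i, HasLaw (X i) P μ) {K : Set 𝓧} (hK : ∀ᵐ y ∂P, y ∈ K)
    {ι : Type*} {f : ι → 𝓧 → ℝ} (hf : ∀ t, Measurable (f t)) {B : ℝ} (hB : 0 < B)
    {D : ℕ} (hD : 0 < D) {S : Set ι} {N : ℕ → Finset ι}
    (hcard : ∀ j, (N j).card ≤ 2 ^ ((j + 6) * D)) (hNS : ∀ j, ∀ t ∈ N j, t ∈ S)
    (hrange : ∀ t ∈ S, ∀ y ∈ K, f t y ∈ Set.Icc 0 (3 / 4 * B))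
    (hnet : ∀ t ∈ S, ∀ j, ∃ s ∈ N j, ∀ y ∈ K, |f t y - f s y| ≤ B / 32 * (1 / 2) ^ j)
    {δ : ℝ} (hδ : 0 < δ) (hδ1 : δ ≤ 1) :
    ∃ A : Set Ω, μ A ≤ ENNReal.ofReal δ ∧ ∀ ω ∉ A, ∀ t ∈ S,
      |empiricalDeviation P (fun i => X i ω) (f t)|
        ≤ B / √(2 * n) * (√(Real.log (2 / δ)) + 4 * √D) := by
  classical
  set l := √(Real.log (2 / δ)) with hl
  have hl0 : 0 ≤ l := Real.sqrt_nonneg _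
  set d := √(D : ℝ) with hd
  have hd0 : 0 ≤ d := Real.sqrt_nonneg _
  have hD1 : (1 : ℝ) ≤ D := by exact_mod_cast hD
  set Q := B / √(2 * n) with hQ
  have hQ0 : 0 ≤ Q := by positivity
  have hint : ∀ t ∈ S, Integrable (f t) P := fun t ht =>
    Integrable.of_mem_Icc 0 (3 / 4 * B) (hf t).aemeasurable (by
      filter_upwards [hK] with y hy using hrange t ht y hy)
  -- Possible links of a chain. The radius is the sum of the net radii at levels `j` and `j + 1`:
  -- `B/32 * (1 + 1/2) = 3B/64`, times `(1/2) ^ j`.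
  let pairs : ℕ → Finset (ι × ι) := fun j => (N j ×ˢ N (j + 1)).filter fun q =>
    ∀ y ∈ K, |f q.1 y - f q.2 y| ≤ 3 * B / 64 * (1 / 2) ^ j
  let A₀ : Set Ω := {ω | ¬ ∀ i, X i ω ∈ K}
  let A₁ : Set Ω := ⋃ t ∈ N 0,
    {ω | (3 / 4 * B - 0) * (l + 3 * d) / √(2 * n) < |empiricalDeviation P (fun i => X i ω) (f t)|}
  let A₂ : ℕ → Set Ω := fun j => ⋃ q ∈ pairs j,
    {ω | (3 * B / 64 * (1 / 2) ^ j - -(3 * B / 64 * (1 / 2) ^ j)) * (l + (j + 4) * d) / √(2 * n)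
      < |empiricalDeviation P (fun i => X i ω) (fun y => f q.1 y - f q.2 y)|}
  have h0 : μ A₀ = 0 := by
    rw [← ae_iff, ae_all_iff]
    intro i
    refine ae_of_ae_map (hP i).aemeasurable ?_
    rwa [(hP i).map_eq]
  have h1 : μ.real A₁ ≤ δ / 2 := by
    -- The net has at most `2 ^ (6 * D)` elements; the extra `1` in `m` buys `δ / 2`, and `6 * D + 1
    -- ≤ 3² * D`.
    have hexp := two_pow_mul_exp_neg_sq_le hδ hδ1 (m := 6 * D + 1) (s := 3) (d := D)
      (by norm_num) (by positivity) (by push_cast; linarith)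
    refine (measureReal_biUnion_le_card_mul _ _ fun t ht =>
      measureReal_lt_abs_empiricalDeviation_le hn hX hP (hf t) (by positivity)
        (by filter_upwards [hK] with y hy using hrange t (hNS 0 t ht) y hy)
        (by positivity)).trans ?_
    have hc : ((N 0).card : ℝ) ≤ 2 ^ (6 * D) := by exact_mod_cast (by simpa using hcard 0)
    refine (mul_le_mul_of_nonneg_right hc (by positivity)).trans ?_
    rw [pow_succ] at hexp
    linarith
  have h2 : ∀ j, μ.real (A₂ j) ≤ δ / 4 * (1 / 2) ^ j := by
    intro j
    -- The exponent `(2 * j + 13) * D` counts pairs; the extra `j + 2` buys the summable failure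
    -- probability `δ / 2 ^ (j + 2)`.
    have hexp := two_pow_mul_exp_neg_sq_le hδ hδ1 (m := (2 * j + 13) * D + (j + 2))
      (s := j + 4) (d := D) (by positivity) (by positivity) (by
        push_cast
        have : (0 : ℝ) ≤ j := Nat.cast_nonneg j
        nlinarith [mul_nonneg this (sub_nonneg.2 hD1), mul_nonneg (mul_nonneg this this)
          (Nat.cast_nonneg (α := ℝ) D), mul_nonneg this (Nat.cast_nonneg (α := ℝ) D)])
    refine (measureReal_biUnion_le_card_mul _ _ fun q hq =>
      measureReal_lt_abs_empiricalDeviation_le hn hX hP ((hf q.1).sub (hf q.2))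
        (neg_lt_self (by positivity))
        (by filter_upwards [hK] with y hy using abs_le.1 ((Finset.mem_filter.1 hq).2 y hy))
        (by positivity)).trans ?_
    have hc : ((pairs j).card : ℝ) ≤ 2 ^ ((2 * j + 13) * D) := by
      have h3 : (pairs j).card ≤ 2 ^ ((2 * j + 13) * D) := by
        calc (pairs j).card ≤ (N j ×ˢ N (j + 1)).card := Finset.card_filter_le _ _
          _ = (N j).card * (N (j + 1)).card := Finset.card_product _ _
          _ ≤ 2 ^ ((j + 6) * D) * 2 ^ ((j + 1 + 6) * D) := by
            gcongr
            · exact hcard j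
            · exact hcard (j + 1)
          _ = 2 ^ ((2 * j + 13) * D) := by rw [← pow_add]; congr 1; ring
      exact_mod_cast h3
    refine (mul_le_mul_of_nonneg_right hc (by positivity)).trans ?_
    rw [pow_add _ _ (j + 2), pow_add _ j 2, mul_right_comm] at hexp
    rw [← le_div_iff₀ (by positivity)] at hexp
    refine hexp.trans_eq ?_
    rw [one_div, inv_pow]
    field_simp
    norm_num
  refine ⟨A₀ ∪ A₁ ∪ ⋃ j, A₂ j, ?_, fun ω hω t ht => ?_⟩
  · have hsum : HasSum (fun j : ℕ => δ / 4 * (1 / 2 : ℝ) ^ j) (δ / 2) := by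
      have := hasSum_geometric_two.mul_left (δ / 4)
      rwa [show δ / 4 * 2 = δ / 2 by ring] at this
    have h3 : μ (⋃ j, A₂ j) ≤ ENNReal.ofReal (δ / 2) := by
      refine (measure_iUnion_le _).trans ?_
      rw [← hsum.tsum_eq, ENNReal.ofReal_tsum_of_nonneg (fun j => by positivity) hsum.summable]
      exact ENNReal.tsum_le_tsum fun j => by
        rw [← ofReal_measureReal (measure_ne_top μ _)]
        exact ENNReal.ofReal_le_ofReal (h2 j)
    have h4 : μ A₁ ≤ ENNReal.ofReal (δ / 2) := by
      rw [← ofReal_measureReal (measure_ne_top μ _)]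
      exact ENNReal.ofReal_le_ofReal h1
    calc μ (A₀ ∪ A₁ ∪ ⋃ j, A₂ j) ≤ μ A₀ + μ A₁ + μ (⋃ j, A₂ j) :=
          (measure_union_le _ _).trans (add_le_add_left (measure_union_le _ _) _)
      _ ≤ 0 + ENNReal.ofReal (δ / 2) + ENNReal.ofReal (δ / 2) := by gcongr; exact h0.le
      _ = ENNReal.ofReal δ := by
        rw [zero_add, ← ENNReal.ofReal_add (by positivity) (by positivity), add_halves]
  · simp only [Set.mem_union, Set.mem_iUnion, not_or, not_exists, A₀, A₁, A₂, Set.mem_ofPred_eq,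
      not_not, not_lt] at hω
    obtain ⟨⟨hωK, hω1⟩, hω2⟩ := hω
    choose s hsN hs using hnet t ht
    set Y := empiricalDeviation P (fun i => X i ω) with hY
    have hYsub : ∀ a ∈ S, ∀ b ∈ S, Y (fun y => f a y - f b y) = Y (f a) - Y (f b) :=
      fun a ha b hb => empiricalDeviation_sub P _ (hint a ha) (hint b hb)
    -- Closed forms of the partial sums of `3/32 * (1/2) ^ j` and `3/32 * (j + 4) * (1/2) ^ j`,
    -- added to the base contributions `3/4` and `3/4 * 3`. The limits are `15/16 ≤ 1` and `51/16 ≤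
    -- 4`.
    have hchain : ∀ J : ℕ, |Y (f (s J))| ≤ Q * (l * (3 / 4 + 3 / 16 * (1 - (1 / 2) ^ J))
        + d * (9 / 4 + 3 / 32 * (10 - 2 * (J + 5) * (1 / 2) ^ J))) := by
      intro J
      induction J with
      | zero =>
        refine (hω1 _ (hsN 0)).trans_eq ?_
        rw [hQ]
        push_cast
        ring
      | succ J ih =>
        have h3 : (s J, s (J + 1)) ∈ pairs J := by
          refine Finset.mem_filter.2 ⟨Finset.mem_product.2 ⟨hsN J, hsN (J + 1)⟩, fun y hy => ?_⟩
          have h4 := hs J y hy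
          have h5 := hs (J + 1) y hy
          rw [abs_sub_comm] at h4
          refine (abs_sub_le _ (f t y) _).trans ((add_le_add h4 h5).trans_eq ?_)
          rw [pow_succ]
          ring
        have h4 := hω2 J _ h3
        simp only [hYsub _ (hNS _ _ (hsN J)) _ (hNS _ _ (hsN (J + 1)))] at h4
        rw [abs_sub_comm] at h4
        have h5 : |Y (f (s (J + 1)))| ≤ |Y (f (s J))| + |Y (f (s (J + 1))) - Y (f (s J))| := by
          have := abs_add_le (Y (f (s J))) (Y (f (s (J + 1))) - Y (f (s J)))
          rwa [add_sub_cancel] at this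
        refine h5.trans ((add_le_add ih h4).trans_eq ?_)
        rw [hQ, pow_succ]
        push_cast
        ring
    -- The last link, from `s J` to `t` itself, is bounded deterministically by twice the net radius
    -- and vanishes as `J → ∞`.
    have hlim : Filter.Tendsto (fun J : ℕ => Q * (l + 4 * d) + 2 * (B / 32 * (1 / 2 : ℝ) ^ J))
        Filter.atTop (nhds (Q * (l + 4 * d))) := by
      have h3 := tendsto_pow_atTop_nhds_zero_of_lt_one (r := (1 / 2 : ℝ)) (by norm_num)
        (by norm_num)
      have h4 := ((h3.const_mul (B / 32)).const_mul 2).const_add (Q * (l + 4 * d))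
      simpa using h4
    refine ge_of_tendsto' hlim fun J => ?_
    have h3 := hchain J
    have h4 : |Y (fun y => f t y - f (s J) y)| ≤ _ :=
      abs_empiricalDeviation_le hK hωK (by positivity) (hs J)
    rw [hYsub t ht _ (hNS _ _ (hsN J))] at h4
    have h5 : |Y (f t)| ≤ |Y (f (s J))| + |Y (f t) - Y (f (s J))| := by
      have := abs_add_le (Y (f (s J))) (Y (f t) - Y (f (s J)))
      rwa [add_sub_cancel] at this
    refine h5.trans (add_le_add (h3.trans ?_) h4)
    have h6 : (0 : ℝ) ≤ (1 / 2) ^ J := by positivity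
    have h7 : (0 : ℝ) ≤ 2 * (J + 5) * (1 / 2) ^ J := by positivity
    rw [mul_comm 4 d]
    gcongr
    · nlinarith
    · linarith

end Chaining

/-! ### Uniform deviation of the clustering risk. -/

section ClusterRisk

variable {p k n : ℕ} {Ω : Type*} [MeasurableSpace Ω] {μ : Measure Ω} [IsProbabilityMeasure μ]
  {P : Measure (EuclideanSpace ℝ (Fin p))} [IsProbabilityMeasure P]
  {M H τ : ℝ} {φ : EuclideanSpace ℝ (Fin p) → ℝ} {Ψ : (Fin k → ℝ) → ℝ}

lemma integrable_clusterLoss (hP : ∀ᵐ x ∂P, x ∈ cube p M)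
    (hc : ConvexOn ℝ Set.univ φ) (hd : Differentiable ℝ φ)
    (hτ : ∀ x y : Fin k → ℝ, 0 ≤ x → 0 ≤ y → |Ψ x - Ψ y| ≤ τ * ∑ j, |x j - y j|)
    (Θ : Fin k → EuclideanSpace ℝ (Fin p)) : Integrable (clusterLoss φ Ψ Θ) P := by
  have h := (continuous_clusterLoss hc hd hτ Θ).continuousOn.integrableOn_compact (μ := P)
    (isCompact_cube (p := p) (M := M))
  rwa [IntegrableOn, Measure.restrict_eq_self_of_ae_mem hP] at h

/-- A uniform bound for the deviation of the empirical risk over all centroids in the cube. -/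
theorem exists_forall_abs_empiricalRisk_sub_populationRisk_le (hn : 0 < n) (hM : 0 ≤ M)
    (hd : Differentiable ℝ φ) (hc : ConvexOn ℝ Set.univ φ) (hΨ : IsAggregator Ψ)
    {X : Fin n → Ω → EuclideanSpace ℝ (Fin p)} (hX : iIndepFun X μ) (hlaw : ∀ i, HasLaw (X i) P μ)
    (hP : ∀ᵐ x ∂P, x ∈ cube p M)
    (hτ : ∀ x y : Fin k → ℝ, 0 ≤ x → 0 ≤ y → |Ψ x - Ψ y| ≤ τ * ∑ j, |x j - y j|)
    (hH : 0 ≤ H)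
    (hL : ∀ x ∈ cube p M, ∀ y ∈ cube p M, ‖gradient φ x - gradient φ y‖ ≤ H * ‖x - y‖)
    {δ : ℝ} (hδ : 0 < δ) (hδ1 : δ ≤ 1) :
    ∃ A : Set Ω, μ A ≤ ENNReal.ofReal δ ∧ ∀ ω ∉ A,
      ∀ Θ : Fin k → EuclideanSpace ℝ (Fin p), (∀ j, Θ j ∈ cube p M) →
        |empiricalRisk φ Ψ (fun i => X i ω) Θ - populationRisk φ Ψ P Θ|
          ≤ τ * k * (4 * H * M ^ 2 * p) / √(2 * n)
            * (√(Real.log (2 / δ)) + 4 * √((k * p : ℕ) : ℝ)) := by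
  set B := τ * k * (4 * H * M ^ 2 * p) with hB_def
  have hB0 : 0 ≤ B := mul_nonneg (lipschitzConst_mul_nonneg hτ) (by positivity)
  have hrange : ∀ Θ ∈ {Θ : Fin k → EuclideanSpace ℝ (Fin p) | ∀ j, Θ j ∈ cube p M},
      ∀ y ∈ cube p M, clusterLoss φ Ψ Θ y ∈ Set.Icc 0 (3 / 4 * B) := fun Θ hΘ y hy =>
    ⟨clusterLoss_nonneg hc hd hΨ Θ y,
      (clusterLoss_le_of_mem_cube hM hc hd hH hL hΨ hτ hΘ hy).trans_eq (by rw [hB_def]; ring)⟩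
  -- If `B = 0`, the loss vanishes on the cube and no chaining is needed; otherwise `k * p > 0`.
  rcases hB0.eq_or_lt with hB | hB
  · refine ⟨{ω | ¬ ∀ i, X i ω ∈ cube p M}, ?_, fun ω hω Θ hΘ => ?_⟩
    · refine le_of_eq_of_le (b := 0) ?_ zero_le
      rw [← ae_iff, ae_all_iff]
      intro i
      refine ae_of_ae_map (hlaw i).aemeasurable ?_
      rwa [(hlaw i).map_eq]
    · rw [← hB, zero_div, zero_mul]
      refine (abs_empiricalDeviation_le hP (not_not.1 hω) le_rfl fun y hy => ?_).trans_eq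
        (mul_zero 2)
      have h := hrange Θ hΘ y hy
      rw [← hB, mul_zero] at h
      rw [abs_of_nonneg h.1]
      exact h.2
  · have hD : 0 < k * p := by
      refine Nat.pos_of_ne_zero fun h => hB.ne' ?_
      rcases Nat.mul_eq_zero.1 h with h | h <;> simp [hB_def, h]
    -- Mesh `2M / 2 ^ (j + 6)` moves the loss by at most `2B / 2 ^ (j + 6) = B/32 * (1/2) ^ j`.
    choose N hcard hN hnet using fun j => exists_grid_cube k p hM (j + 6)
    refine exists_forall_abs_empiricalDeviation_le hn hX hlaw hP
      (fun Θ => (continuous_clusterLoss hc hd hτ Θ).measurable) hB hD hcard hN hrange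
      (fun Θ hΘ j => ?_) hδ hδ1
    obtain ⟨Θ', hΘ', h⟩ := hnet j Θ hΘ
    refine ⟨Θ', hΘ', fun y hy => ?_⟩
    refine (abs_clusterLoss_sub_le hM hc hd hH hL hτ hΘ (hN j Θ' hΘ') (by positivity) h
      hy).trans_eq ?_
    rw [hB_def, one_div, inv_pow, pow_add]
    field_simp
    norm_num

end ClusterRisk

theorem mainTheorem7 {p k n : ℕ} (hn : 0 < n)
    {Ω : Type*} [MeasurableSpace Ω] (μ : Measure Ω) [IsProbabilityMeasure μ]
    (P : Measure (EuclideanSpace ℝ (Fin p))) [IsProbabilityMeasure P]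
    (M : ℝ) (hM : 0 ≤ M)
    (φ : EuclideanSpace ℝ (Fin p) → ℝ) (hφ_diff : Differentiable ℝ φ)
    (hφ_conv : ConvexOn ℝ Set.univ φ)
    (Ψ : (Fin k → ℝ) → ℝ) (hΨ : IsAggregator Ψ)
    -- the data are i.i.d. from `P`, which is supported on the cube
    (X : Fin n → Ω → EuclideanSpace ℝ (Fin p))
    (hX_indep : iIndepFun X μ) (hX_law : ∀ i, HasLaw (X i) P μ)
    (hP : P (cube p M) = 1)
    -- `Ψ` is `τ`-Lipschitz for the `ℓ¹` norm on the nonnegative orthant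
    (τ : ℝ)
    (hτ : ∀ x y : Fin k → ℝ, 0 ≤ x → 0 ≤ y → |Ψ x - Ψ y| ≤ τ * ∑ j, |x j - y j|)
    -- the gradient of `φ` is `H`-Lipschitz on the cube
    (H : ℝ) (hH : 0 ≤ H)
    (hφ_lip : ∀ x ∈ cube p M, ∀ y ∈ cube p M, ‖gradient φ x - gradient φ y‖ ≤ H * ‖x - y‖)
    -- `Θhat` is a global minimizer of the empirical risk; if there are several, it is one in the cube
    (Θhat : Ω → Fin k → EuclideanSpace ℝ (Fin p))
    (hΘhat : ∀ᵐ ω ∂μ, IsGlobalMinimizer (empiricalRisk φ Ψ fun i => X i ω) (Θhat ω))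
    (hΘhat_cube : ∀ᵐ ω ∂μ,
      (∃ Θ, Θ ≠ Θhat ω ∧ IsGlobalMinimizer (empiricalRisk φ Ψ fun i => X i ω) Θ) →
        ∀ j, Θhat ω j ∈ cube p M)
    -- `Θstar` is a global minimizer of the population risk
    (Θstar : Fin k → EuclideanSpace ℝ (Fin p))
    (hΘstar : IsGlobalMinimizer (populationRisk φ Ψ P) Θstar)
    (δ : ℝ) (hδ_pos : 0 < δ) (hδ_le : δ ≤ 1) :
    ∃ E : Set Ω, MeasurableSet E ∧ 1 - δ ≤ μ.real E ∧ ∀ ω ∈ E,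
      |populationRisk φ Ψ P (Θhat ω) - populationRisk φ Ψ P Θstar| ≤
        192 * Real.sqrt Real.pi * τ * H * M ^ 2 * ((k : ℝ) * (p : ℝ)) ^ (3 / 2 : ℝ)
            * (n : ℝ) ^ (-(1 / 2) : ℝ)
          + 8 * τ * H * M ^ 2 * (p : ℝ) * (k : ℝ)
            * Real.sqrt (Real.log (2 / δ) / (2 * (n : ℝ))) := by
  have hPK : ∀ᵐ x ∂P, x ∈ cube p M :=
    (prob_compl_eq_zero_iff isClosed_cube.measurableSet).2 hP
  have hXK : ∀ᵐ ω ∂μ, ∀ i, X i ω ∈ cube p M := ae_all_iff.2 fun i =>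
    ae_of_ae_map (hX_law i).aemeasurable (by rwa [(hX_law i).map_eq])
  obtain ⟨A, hA, hdev⟩ := exists_forall_abs_empiricalRisk_sub_populationRisk_le (k := k) hn hM
    hφ_diff hφ_conv hΨ hX_indep hX_law hPK hτ hH hφ_lip hδ_pos hδ_le
  have hmem : ∀ᵐ ω ∂μ, IsGlobalMinimizer (empiricalRisk φ Ψ fun i => X i ω) (Θhat ω) ∧
      ∀ j, Θhat ω j ∈ cube p M := by
    filter_upwards [hXK, hΘhat, hΘhat_cube] with ω h1 h2 h3
    exact ⟨h2, h2.mem_cube_of_empiricalRisk hM hφ_conv hφ_diff hΨ h1 h3⟩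
  obtain ⟨Θ₀, hΘ₀, hle⟩ := exists_mem_cube_clusterLoss_le hM hφ_conv hφ_diff hΨ Θstar
  have hΘ₀_le : populationRisk φ Ψ P Θ₀ ≤ populationRisk φ Ψ P Θstar :=
    integral_mono_ae (integrable_clusterLoss hPK hφ_conv hφ_diff hτ Θ₀)
      (integrable_clusterLoss hPK hφ_conv hφ_diff hτ Θstar)
      (by filter_upwards [hPK] with x hx using hle x hx)
  set A' : Set Ω := A ∪ {ω | ¬ (IsGlobalMinimizer (empiricalRisk φ Ψ fun i => X i ω) (Θhat ω) ∧
      ∀ j, Θhat ω j ∈ cube p M)} with hA'_def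
  have hA' : μ A' ≤ ENNReal.ofReal δ :=
    (measure_union_le _ _).trans (by rw [ae_iff.1 hmem, add_zero]; exact hA)
  -- The exceptional set need not be measurable, as `Θhat` is an arbitrary function of `ω`; its
  -- measurable hull has the same measure.
  refine ⟨(toMeasurable μ A')ᶜ, (measurableSet_toMeasurable μ A').compl, ?_, fun ω hω => ?_⟩
  · rw [probReal_compl_eq_one_sub (measurableSet_toMeasurable μ A')]
    gcongr
    rw [measureReal_def, measure_toMeasurable]
    exact ENNReal.toReal_le_of_le_ofReal hδ_pos.le hA'
  · have hω' : ω ∉ A' := fun h => hω (subset_toMeasurable μ A' h)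
    simp only [hA'_def, Set.mem_union, Set.mem_ofPred_eq, not_or, not_not] at hω'
    obtain ⟨hωA, hmin, hcube⟩ := hω'
    have h1 := (abs_le.1 (hdev ω hωA (Θhat ω) hcube)).1
    have h2 := (abs_le.1 (hdev ω hωA Θ₀ hΘ₀)).2
    have h3 := hmin Θ₀
    rw [abs_of_nonneg (sub_nonneg.2 (hΘstar (Θhat ω)))]
    set R := τ * k * (4 * H * M ^ 2 * p) / √(2 * n)
      * (√(Real.log (2 / δ)) + 4 * √((k * p : ℕ) : ℝ)) with hR
    -- One `R` for `Θhat ω` and one for `Θ₀`; between them, `Θhat ω` has empirical risk at most that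
    -- of `Θ₀`, whose population risk is at most that of `Θstar`.
    refine le_trans (b := 2 * R) (by linarith) ?_
    have hn' : (0 : ℝ) < n := by exact_mod_cast hn
    have hB0 : 0 ≤ τ * k * (H * M ^ 2 * p) :=
      mul_nonneg (lipschitzConst_mul_nonneg hτ) (by positivity)
    have hD0 : (0 : ℝ) ≤ k * p := by positivity
    have e1 : ((k : ℝ) * (p : ℝ)) ^ (3 / 2 : ℝ) = k * p * √(k * p) := by
      rw [show (3 / 2 : ℝ) = 1 + 1 / 2 by norm_num, Real.rpow_add_of_nonneg hD0 zero_le_one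
        (by norm_num), Real.rpow_one, Real.sqrt_eq_rpow]
    have e2 : (n : ℝ) ^ (-(1 / 2) : ℝ) = 1 / √n := by
      rw [Real.rpow_neg hn'.le, Real.sqrt_eq_rpow, one_div (_ ^ _)]
    have e3 : √(Real.log (2 / δ) / (2 * (n : ℝ))) = √(Real.log (2 / δ)) / √(2 * n) :=
      Real.sqrt_div' _ (by positivity)
    have e4 : 1 / √(2 * (n : ℝ)) ≤ 1 / √n := by
      gcongr
      linarith
    have e5 : 1 ≤ √Real.pi := Real.one_le_sqrt.2 (by linarith [Real.pi_gt_three])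
    have e6 : 32 * (1 / √(2 * (n : ℝ))) ≤ 192 * √Real.pi * (1 / √n) := by
      gcongr
      linarith
    have e7 := mul_le_mul_of_nonneg_left e6 (mul_nonneg hB0 (Real.sqrt_nonneg ((k : ℝ) * p)))
    rw [hR, e1, e2, e3]
    push_cast
    calc 2 * (τ * k * (4 * H * M ^ 2 * p) / √(2 * n) * (√(Real.log (2 / δ)) + 4 * √(k * p)))
        = τ * k * (H * M ^ 2 * p) * √(k * p) * (32 * (1 / √(2 * n)))
          + 8 * τ * H * M ^ 2 * p * k * (√(Real.log (2 / δ)) / √(2 * n)) := by ring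
      _ ≤ τ * k * (H * M ^ 2 * p) * √(k * p) * (192 * √Real.pi * (1 / √n))
          + 8 * τ * H * M ^ 2 * p * k * (√(Real.log (2 / δ)) / √(2 * n)) := by gcongr
      _ = _ := by ring
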